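/- Let $c\in\mathbb C\setminus\{0\}$, $g(x,y)=\frac{c}{x-y}$, $f(x,y)=\frac{x-y+c}{x-y}$, $h(x,y)=\frac{x-y+c}{c}$, and let $D\subset\mathbb C$ be open (the domain of the spectral parameters). Put $\bar\jmath=4-j$ for $j=1,2,3$. Use the gradings $[1]=[2]=0,\ [3]=1$ for $\mathfrak{gl}(2|1)$ and $\widetilde{[1]}=0,\ \widetilde{[2]}=\widetilde{[3]}=1$ for $\mathfrak{gl}(1|2)$; objects attached to $\mathfrak{gl}(1|2)$ carry a tilde. *Yangians.* $Y(\mathfrak{gl}(2|1))$ is the unital associative $\mathbb C$-algebra generated by $T_{ij}(w)$, $1\le i,j\le 3$, $w\in D$, with the relations, for $u\ne v$, $$T_{ij}(u)T_{kl}(v)-(-1)^{([i]+[j])([k]+[l])}T_{kl}(v)T_{ij}(u)=(-1)^{[i]([k]+[l])+[k][l]}g(u,v)\bigl(T_{kj}(v)T_{il}(u)-T_{kj}(u)T_{il}(v)\bigr),$$ and $\operatorname{str}T(w)=\sum_i(-1)^{[i]}T_{ii}(w)$. $Y(\mathfrak{gl}(1|2))$, with generators $\widetilde T_{ij}(w)$,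 is defined in the same way with $\widetilde{[\,\cdot\,]}$. *Models.* A model is a representation of the Yangian on a complex vector space with a vector $\Omega$ and a linear functional $\Omega^\dagger$, $\Omega^\dagger\Omega=1$, such that $T_{ij}(w)\Omega=0$ for $i>j$, $\Omega^\dagger T_{ij}(w)=0$ for $i<j$, $T_{ii}(w)\Omega=\lambda_i(w)\Omega$, $\Omega^\dagger T_{ii}(w)=\lambda_i(w)\Omega^\dagger$ for scalar functions $\lambda_i$ on $D$, and such that every vacuum expectation value $\Omega^\dagger A\,T_{ij}(w)\,B\,\Omega$ ($A,B$ in the Yangian) is continuous in $w\in D$. *Bethe vectors.* For $\bar u=(u_1,\dots,u_a)$, $\bar v=(v_1,\dots,v_b)$ in $D$, a function evaluated on sets of parameters denotes the product over these sets. Products of operators over a set are ordered by increasing label, $T_{ij}(\bar x)=T_{ij}(x_1)\cdots T_{ij}(x_n)$, and for odd entries $$\mathbb T_{ij}(\bar x)=\frac{T_{ij}(x_1)\cdots T_{ij}(x_n)}{\prod_{\ell>m}h(x_\ell,x_m)}\ (i<j),\qquad \mathbb T_{ij}(\bar x)=\frac{T_{ij}(x_1)\cdots T_{ij}(x_n)}{\prod_{\ell>m}h(x_m,x_\ell)}\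 (i>j).$$ All sums below run over partitions $\bar u=\bar u_{I}\sqcup\bar u_{II}$, $\bar v=\bar v_{I}\sqcup\bar v_{II}$ with $\#\bar u_I=\#\bar v_I$. In a $\mathfrak{gl}(2|1)$ model, with $W=\dfrac{g(\bar v_I,\bar u_I)f(\bar u_I,\bar u_{II})g(\bar v_{II},\bar v_I)h(\bar u_I,\bar u_I)}{f(\bar v,\bar u)\lambda_2(\bar u)\lambda_2(\bar v_{II})}$, $$\mathbb B_{a,b}(\bar u;\bar v)=\sum W\,\mathbb T_{13}(\bar u_I)T_{12}(\bar u_{II})\mathbb T_{23}(\bar v_{II})\Omega,\qquad \mathbb C_{a,b}(\bar u;\bar v)=(-1)^{\frac{b(b-1)}2}\sum W\,\Omega^\dagger\mathbb T_{32}(\bar v_{II})T_{21}(\bar u_{II})\mathbb T_{31}(\bar u_I).$$ In a $\mathfrak{gl}(1|2)$ model, with $\widetilde W=\dfrac{g(\bar u_I,\bar v_I)f(\bar v_I,\bar v_{II})g(\bar u_{II},\bar u_I)h(\bar v_I,\bar v_I)}{\widetilde\lambda_2(\bar u_{II})\widetilde\lambda_2(\bar v)f(\bar u,\bar v)}$,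 $$\widetilde{\mathbb B}_{a,b}(\bar u;\bar v)=(-1)^a\sum \widetilde W\,\widetilde{\mathbb T}_{13}(\bar v_I)\widetilde T_{23}(\bar v_{II})\widetilde{\mathbb T}_{12}(\bar u_{II})\widetilde\Omega,\qquad \widetilde{\mathbb C}_{a,b}(\bar u;\bar v)=(-1)^{\frac{a(a-1)}2}\sum \widetilde W\,\widetilde\Omega^\dagger\widetilde{\mathbb T}_{21}(\bar u_{II})\widetilde T_{32}(\bar v_{II})\widetilde{\mathbb T}_{31}(\bar v_I).$$ *Form factors.* For $z\in D$, $$\mathcal F^{(i,j)}\Bigl(z\Big|\begin{smallmatrix}\bar u^C&\bar u^B\\ \bar v^C&\bar v^B\end{smallmatrix}\Bigr)^{a',a}_{b',b}=\mathbb C_{a',b'}(\bar u^C;\bar v^C)\,T_{ij}(z)\,\mathbb B_{a,b}(\bar u^B;\bar v^B),$$ and $\widetilde{\mathcal F}^{(i,j)}$ is defined in the same way from $\widetilde{\mathbb C}$, $\widetilde T_{ij}$, $\widetilde{\mathbb B}$. **Theorem.** There is an isomorphism of algebras $\varphi:Y(\mathfrak{gl}(2|1))\to Y(\mathfrak{gl}(1|2))$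 with $$\varphi(T_{ij}(w))=(-1)^{[j][i]+[j]+1}\,\widetilde T_{\bar\jmath,\bar\imath}(w),\qquad \varphi(\operatorname{str}T(w))=\operatorname{str}\widetilde T(w).$$ For every $\mathfrak{gl}(1|2)$ model with vacuum eigenvalues $\widetilde\lambda_k$, the representation pulled back along $\varphi$, with the same $\Omega$ and $\Omega^\dagger$, is a $\mathfrak{gl}(2|1)$ model with vacuum eigenvalues $\lambda_k=-\widetilde\lambda_{\bar k}$. Moreover, for every $\mathfrak{gl}(2|1)$ model whose vacuum eigenvalues are $\lambda_k=-\widetilde\lambda_{\bar k}$ ($k=1,2,3$), all $i,j$, all $z\in D$, and all finite families $\bar u^C,\bar u^B,\bar v^C,\bar v^B$ of points of $D$, of cardinalities $a',a,b',b$, for which the Bethe vectors are defined (no denominator vanishes), in particular for on-shell Bethe vectors, $$\widetilde{\mathcal F}^{(i,j)}\Bigl(z\Big|\begin{smallmatrix}\bar u^C&\bar u^B\\ \bar v^C&\bar v^B\end{smallmatrix}\Bigr)^{a',a}_{b',b}=(-1)^{\widetilde{[j]}\,\widetilde{[i]}+\widetilde{[j]}+1}\;\mathcal F^{(\bar\jmath,\bar\imath)}\Bigl(z\Big|\begin{smallmatrix}\bar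 v^C&\bar v^B\\ \bar u^C&\bar u^B\end{smallmatrix}\Bigr)^{b',b}_{a',a}.$$ -/

import Mathlib

noncomputable section

/-! Indices `1, 2, 3` are `0, 1, 2 : Fin 3`, so that `4 - j` is `Fin.rev j`. -/

/-- The grading `[1] = [2] = 0`, `[3] = 1` of `gl(2|1)`. -/
def grading21 : Fin 3 → ℕ := ![0, 0, 1]

/-- The grading `[1] = 0`, `[2] = [3] = 1` of `gl(1|2)`. -/
def grading12 : Fin 3 → ℕ := ![0, 1, 1]

/-- The rational function `g(x,y) = c / (x - y)`. -/
def gFun (c x y : ℂ) : ℂ := c / (x - y)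

/-- The rational function `f(x,y) = (x - y + c) / (x - y)`. -/
def fFun (c x y : ℂ) : ℂ := (x - y + c) / (x - y)

/-- The rational function `h(x,y) = f(x,y) / g(x,y) = (x - y + c) / c`. -/
def hFun (c x y : ℂ) : ℂ := (x - y + c) / c

/-- The free generator `T_ij(w)`, with spectral parameter `w` in `D`. -/
def freeT (D : Set ℂ) (i j : Fin 3) (w : D) : FreeAlgebra ℂ (Fin 3 × Fin 3 × D) :=
  FreeAlgebra.ι ℂ (i, j, w)

/-- The `RTT` relation `R(u,v) T₁(u) T₂(v) = T₂(v) T₁(u) R(u,v)`, `R = 1 + g P` with `P` the graded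
permutation, in components:
`T_ij(u) T_kl(v) - (-1)^(([i]+[j])([k]+[l])) T_kl(v) T_ij(u)
  = (-1)^([i]([k]+[l])+[k][l]) g(u,v) (T_kj(v) T_il(u) - T_kj(u) T_il(v))` for `u ≠ v`. -/
inductive RTTRel (p : Fin 3 → ℕ) (c : ℂ) (D : Set ℂ) :
    FreeAlgebra ℂ (Fin 3 × Fin 3 × D) → FreeAlgebra ℂ (Fin 3 × Fin 3 × D) → Prop
  | comm (i j k l : Fin 3) (u v : D) (huv : u ≠ v) :
      RTTRel p c D
        (freeT D i j u * freeT D k l v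
          - (-1 : ℂ) ^ ((p i + p j) * (p k + p l)) • (freeT D k l v * freeT D i j u))
        (((-1 : ℂ) ^ (p i * (p k + p l) + p k * p l) * gFun c u v) •
          (freeT D k j v * freeT D i l u - freeT D k j u * freeT D i l v))

/-- The `RTT` algebra (Yangian) for the grading `p`: the unital algebra generated by the entries
`T_ij(w)`, `w ∈ D`, subject to the `RTT` relation. -/
abbrev Yangian (p : Fin 3 → ℕ) (c : ℂ) (D : Set ℂ) : Type :=
  RingQuot (RTTRel p c D)

/-- The generator `T_ij(w)` of the Yangian. -/
def Yangian.T (p : Fin 3 → ℕ) (c : ℂ) {D : Set ℂ} (i j : Fin 3) (w : D) : Yangian p c D :=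
  RingQuot.mkAlgHom ℂ (RTTRel p c D) (freeT D i j w)

/-- The transfer matrix `str T(w) = ∑ i, (-1)^[i] T_ii(w)`. -/
def Yangian.str (p : Fin 3 → ℕ) (c : ℂ) {D : Set ℂ} (w : D) : Yangian p c D :=
  ∑ i : Fin 3, (-1 : ℂ) ^ p i • Yangian.T p c i i w

/-- A (generalized) integrable model on the space of states `H`: a representation of the `RTT`
algebra with a pseudovacuum `Ω` and a dual pseudovacuum `Ω†`, normalized by `Ω† Ω = 1`, with vacuum
eigenvalues `λ_i(w)`. The set `D` is the domain of regularity of the monodromy matrix; regularity is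
only asked in the weak form that vacuum expectation values of products of monodromy matrix entries
are continuous in each spectral parameter. -/
structure Model (p : Fin 3 → ℕ) (c : ℂ) (D : Set ℂ) (H : Type*) [AddCommGroup H] [Module ℂ H] where
  /-- The action of the `RTT` algebra on the space of states. -/
  rep : Yangian p c D →ₐ[ℂ] Module.End ℂ H
  /-- The pseudovacuum `Ω`. -/
  vac : H
  /-- The dual pseudovacuum `Ω†`. -/
  covac : Module.Dual ℂ H
  /-- The vacuum eigenvalues `λ_i(w)`. -/
  lam : Fin 3 → D → ℂ
  covac_vac : covac vac = 1
  lower_vac : ∀ (i j : Fin 3) (w : D), j < i → rep (Yangian.T p c i j w) vac = 0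
  covac_raise : ∀ (i j : Fin 3) (w : D), i < j → covac ∘ₗ rep (Yangian.T p c i j w) = 0
  diag_vac : ∀ (i : Fin 3) (w : D), rep (Yangian.T p c i i w) vac = lam i w • vac
  covac_diag : ∀ (i : Fin 3) (w : D), covac ∘ₗ rep (Yangian.T p c i i w) = lam i w • covac
  regular : ∀ (A B : Yangian p c D) (i j : Fin 3),
    Continuous fun w : D => covac (rep (A * Yangian.T p c i j w * B) vac)

/-- The shorthand product `F(x_S, y_S') = ∏_{k ∈ S} ∏_{l ∈ S'} F(x_k, y_l)` of a function of two
variables over subsets of two sets of parameters. -/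
def setProd {D : Set ℂ} (F : ℂ → ℂ → ℂ) {m n : ℕ} (x : Fin m → D) (S : Finset (Fin m))
    (y : Fin n → D) (S' : Finset (Fin n)) : ℂ :=
  ∏ k ∈ S, ∏ l ∈ S', F (x k) (y l)

namespace Yangian

variable (p : Fin 3 → ℕ) (c : ℂ) {D : Set ℂ}

/-- The product `T_ij(x_S)`, taken in the increasing order of the labels. -/
def prodT (i j : Fin 3) {n : ℕ} (x : Fin n → D) (S : Finset (Fin n)) : Yangian p c D :=
  ((S.sort (· ≤ ·)).map fun k => Yangian.T p c i j (x k)).prod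

/-- The symmetric product of odd raising operators (`i < j`),
`T_ij(x_1) ⋯ T_ij(x_n) / ∏_{l > m} h(x_l, x_m)`, over the subset `S` of the parameters. -/
def symRaise (i j : Fin 3) {n : ℕ} (x : Fin n → D) (S : Finset (Fin n)) : Yangian p c D :=
  (∏ l ∈ S, ∏ m ∈ S with m < l, hFun c (x l) (x m))⁻¹ • prodT p c i j x S

/-- The symmetric product of odd lowering operators (`i > j`),
`T_ij(x_1) ⋯ T_ij(x_n) / ∏_{l > m} h(x_m, x_l)`, over the subset `S` of the parameters. -/
def symLower (i j : Fin 3) {n : ℕ} (x : Fin n → D) (S : Finset (Fin n)) : Yangian p c D :=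
  (∏ l ∈ S, ∏ m ∈ S with m < l, hFun c (x m) (x l))⁻¹ • prodT p c i j x S

end Yangian

/-- The coefficient, for the parts `u_I`, `u_II`, `v_I`, `v_II`,
`g(v_I,u_I) f(u_I,u_II) g(v_II,v_I) h(u_I,u_I) / (f(v,u) λ₂(u) λ₂(v_II))` in the `gl(2|1)` Bethe
vectors, where `I` and `J` are the sets of labels of `u_I` and `v_I`. -/
def coeff21 (c : ℂ) {D : Set ℂ} (lam2 : D → ℂ) {a b : ℕ} (u : Fin a → D) (v : Fin b → D)
    (I : Finset (Fin a)) (J : Finset (Fin b)) : ℂ :=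
  setProd (gFun c) v J u I * setProd (fFun c) u I u Iᶜ * setProd (gFun c) v Jᶜ v J
      * setProd (hFun c) u I u I
    / (setProd (fFun c) v Finset.univ u Finset.univ * (∏ k, lam2 (u k)) * ∏ k ∈ Jᶜ, lam2 (v k))

/-- The coefficient, for the parts `u_I`, `u_II`, `v_I`, `v_II`,
`g(u_I,v_I) f(v_I,v_II) g(u_II,u_I) h(v_I,v_I) / (λ₂(u_II) λ₂(v) f(u,v))` in the `gl(1|2)` Bethe
vectors, where `I` and `J` are the sets of labels of `u_I` and `v_I`. -/
def coeff12 (c : ℂ) {D : Set ℂ} (lam2 : D → ℂ) {a b : ℕ} (u : Fin a → D) (v : Fin b → D)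
    (I : Finset (Fin a)) (J : Finset (Fin b)) : ℂ :=
  setProd (gFun c) u I v J * setProd (fFun c) v J v Jᶜ * setProd (gFun c) u Iᶜ u I
      * setProd (hFun c) v J v J
    / ((∏ k ∈ Iᶜ, lam2 (u k)) * (∏ k, lam2 (v k)) * setProd (fFun c) u Finset.univ v Finset.univ)

namespace Model

variable {c : ℂ} {D : Set ℂ} {H : Type*} [AddCommGroup H] [Module ℂ H]

/-- The `gl(2|1)` Bethe vector `𝔹_{a,b}(u; v)`: the sum over partitions of `u` into `u_I`, `u_II` and
of `v` into `v_I`, `v_II` with `#u_I = #v_I` of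
`coeff · 𝕋₁₃(u_I) T₁₂(u_II) 𝕋₂₃(v_II) Ω`. -/
def bethe21 (M : Model grading21 c D H) {a b : ℕ} (u : Fin a → D) (v : Fin b → D) : H :=
  ∑ P : Finset (Fin a) × Finset (Fin b) with P.1.card = P.2.card,
    coeff21 c (M.lam 1) u v P.1 P.2 •
      M.rep (Yangian.symRaise grading21 c 0 2 u P.1 * Yangian.prodT grading21 c 0 1 u P.1ᶜ
        * Yangian.symRaise grading21 c 1 2 v P.2ᶜ) M.vac

/-- The dual `gl(2|1)` Bethe vector `ℂ_{a,b}(u; v)`: the sum over the same partitions of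
`(-1)^(b(b-1)/2) · coeff · Ω† 𝕋₃₂(v_II) T₂₁(u_II) 𝕋₃₁(u_I)`. -/
def dualBethe21 (M : Model grading21 c D H) {a b : ℕ} (u : Fin a → D) (v : Fin b → D) :
    Module.Dual ℂ H :=
  (-1 : ℂ) ^ (b * (b - 1) / 2) •
    ∑ P : Finset (Fin a) × Finset (Fin b) with P.1.card = P.2.card,
      coeff21 c (M.lam 1) u v P.1 P.2 •
        (M.covac ∘ₗ M.rep (Yangian.symLower grading21 c 2 1 v P.2ᶜ
          * Yangian.prodT grading21 c 1 0 u P.1ᶜ * Yangian.symLower grading21 c 2 0 u P.1))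

/-- The `gl(1|2)` Bethe vector `𝔹_{a,b}(u; v)`: the sum over partitions of `u` into `u_I`, `u_II` and
of `v` into `v_I`, `v_II` with `#u_I = #v_I` of
`(-1)^a · coeff · 𝕋₁₃(v_I) T₂₃(v_II) 𝕋₁₂(u_II) Ω`. -/
def bethe12 (M : Model grading12 c D H) {a b : ℕ} (u : Fin a → D) (v : Fin b → D) : H :=
  (-1 : ℂ) ^ a •
    ∑ P : Finset (Fin a) × Finset (Fin b) with P.1.card = P.2.card,
      coeff12 c (M.lam 1) u v P.1 P.2 •
        M.rep (Yangian.symRaise grading12 c 0 2 v P.2 * Yangian.prodT grading12 c 1 2 v P.2ᶜ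
          * Yangian.symRaise grading12 c 0 1 u P.1ᶜ) M.vac

/-- The dual `gl(1|2)` Bethe vector `ℂ_{a,b}(u; v)`: the sum over the same partitions of
`(-1)^(a(a-1)/2) · coeff · Ω† 𝕋₂₁(u_II) T₃₂(v_II) 𝕋₃₁(v_I)`. -/
def dualBethe12 (M : Model grading12 c D H) {a b : ℕ} (u : Fin a → D) (v : Fin b → D) :
    Module.Dual ℂ H :=
  (-1 : ℂ) ^ (a * (a - 1) / 2) •
    ∑ P : Finset (Fin a) × Finset (Fin b) with P.1.card = P.2.card,
      coeff12 c (M.lam 1) u v P.1 P.2 •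
        (M.covac ∘ₗ M.rep (Yangian.symLower grading12 c 1 0 u P.1ᶜ
          * Yangian.prodT grading12 c 2 1 v P.2ᶜ * Yangian.symLower grading12 c 2 0 v P.2))

/-- The `gl(2|1)` form factor `ℂ_{a',b'}(uC; vC) T_ij(z) 𝔹_{a,b}(uB; vB)`. -/
def formFactor21 (M : Model grading21 c D H) (i j : Fin 3) (z : D) {a' a b' b : ℕ}
    (uC : Fin a' → D) (uB : Fin a → D) (vC : Fin b' → D) (vB : Fin b → D) : ℂ :=
  M.dualBethe21 uC vC (M.rep (Yangian.T grading21 c i j z) (M.bethe21 uB vB))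

/-- The `gl(1|2)` form factor `ℂ_{a',b'}(uC; vC) T_ij(z) 𝔹_{a,b}(uB; vB)`. -/
def formFactor12 (M : Model grading12 c D H) (i j : Fin 3) (z : D) {a' a b' b : ℕ}
    (uC : Fin a' → D) (uB : Fin a → D) (vC : Fin b' → D) (vB : Fin b → D) : ℂ :=
  M.dualBethe12 uC vC (M.rep (Yangian.T grading12 c i j z) (M.bethe12 uB vB))

end Model

end

/-! The relabelling `k ↦ k.rev` complements the parity: `grading12 k.rev = 1 - grading21 k`. Hence
the parity of each `T_ij` is preserved while the graded permutation changes sign. Transposing the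
matrix turns the row exchange in the RTT relation into a column exchange, which has the opposite
sign because `g(v,u) = -g(u,v)`. The two sign changes cancel up to the factors `transposeSign`, so
transposition is a homomorphism that keeps the order of products (`transposeEquiv`).

Pulling a model back along it matches the Bethe vectors term by term, with the two families of
parameters exchanged (`bethe21_transpose`, `dualBethe21_transpose`). This gives the identity for the
pulled-back model.

Another `gl(2|1)` model with the same eigenvalues may live on a different space, but form factors
are linear combinations of vacuum expectation values, and these depend only on the eigenvalues
(`vev_eq_of_lam_eq`). For distinct parameters, exchange relations bring to the front a letter that
acts on `Ω†` by zero or a scalar, or else the last letter acts so on `Ω`. Coinciding parameters,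
where the relations say nothing, follow by continuity. -/

noncomputable section

namespace Yangian

/-! ### Row and column forms of the exchange relations -/

section Relations

variable {p : Fin 3 → ℕ} {c : ℂ} {D : Set ℂ}

/-- The defining relation of the Yangian, for its generators. -/
theorem T_rtt (i j k l : Fin 3) {u v : D} (huv : u ≠ v) :
    T p c i j u * T p c k l v
        - (-1 : ℂ) ^ ((p i + p j) * (p k + p l)) • (T p c k l v * T p c i j u)
      = ((-1 : ℂ) ^ (p i * (p k + p l) + p k * p l) * gFun c u v) •
          (T p c k j v * T p c i l u - T p c k j u * T p c i l v) := by
  have h := RingQuot.mkAlgHom_rel ℂ (RTTRel.comm (p := p) (c := c) i j k l u v huv)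
  simp only [map_sub, map_mul, map_smul] at h
  exact h

/-- Products of two generators can be rewritten with the row indices exchanged. -/
theorem T_mul_T_swap_rows (i j k l : Fin 3) {u v : D} (huv : u ≠ v) :
    T p c i j u * T p c k l v
      = (-1 : ℂ) ^ ((p i + p j) * (p k + p l)) • (T p c k l v * T p c i j u)
        + ((-1 : ℂ) ^ (p i * (p k + p l) + p k * p l) * gFun c u v) •
          (T p c k j v * T p c i l u - T p c k j u * T p c i l v) := by
  rw [← T_rtt i j k l huv]; abel

theorem gFun_swap (c x y : ℂ) : gFun c y x = -gFun c x y := by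
  unfold gFun
  rw [← neg_sub x y, div_neg]

/-- The defining relation, with the generators on the right-hand side in the opposite order. -/
theorem T_rtt_swap (i j k l : Fin 3) {u v : D} (huv : u ≠ v) :
    T p c i j u * T p c k l v
        - (-1 : ℂ) ^ ((p i + p j) * (p k + p l)) • (T p c k l v * T p c i j u)
      = (-(-1 : ℂ) ^ ((p i + p j) * (p k + p l) + p k * (p i + p j) + p i * p j) * gFun c u v) •
          (T p c i l v * T p c k j u - T p c i l u * T p c k j v) := by
  -- The graded commutator is antisymmetric up to its own sign, so the relation for the reversed
  -- pair describes the same left-hand side.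
  have h := T_rtt (p := p) (c := c) k l i j huv.symm
  have e : (-1 : ℂ) ^ ((p i + p j) * (p k + p l)) * (-1 : ℂ) ^ ((p i + p j) * (p k + p l)) = 1 := by
    rw [← mul_pow]; norm_num
  rw [mul_comm (p k + p l)] at h
  calc _ = -(-1 : ℂ) ^ ((p i + p j) * (p k + p l)) • (T p c k l v * T p c i j u
          - (-1 : ℂ) ^ ((p i + p j) * (p k + p l)) • (T p c i j u * T p c k l v)) := by
        rw [smul_sub, smul_smul, neg_mul, e]; module
    _ = _ := by
        rw [h, gFun_swap, pow_add, pow_add, pow_add]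
        module

/-- Products of two generators can be rewritten with the column indices exchanged. -/
theorem T_mul_T_swap_cols (i j k l : Fin 3) {u v : D} (huv : u ≠ v) :
    T p c i j u * T p c k l v
      = (-1 : ℂ) ^ ((p i + p j) * (p k + p l)) • (T p c k l v * T p c i j u)
        + (-(-1 : ℂ) ^ ((p i + p j) * (p k + p l) + p k * (p i + p j) + p i * p j) * gFun c u v) •
          (T p c i l v * T p c k j u - T p c i l u * T p c k j v) := by
  rw [← T_rtt_swap i j k l huv]; abel

/-- Algebra homomorphisms out of the Yangian are determined by their values on the generators. -/
theorem algHom_ext {A : Type*} [Semiring A] [Algebra ℂ A] {F G : Yangian p c D →ₐ[ℂ] A}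
    (h : ∀ i j w, F (T p c i j w) = G (T p c i j w)) : F = G := by
  apply RingQuot.ringQuot_ext'
  ext x
  exact h x.1 x.2.1 x.2.2

end Relations

/-! ### The transposition isomorphism of the two Yangians -/

section Transpose

/-- The sign `(-1)^([j][i] + [j] + 1)` in the transposition map between Yangians. -/
def transposeSign (p : Fin 3 → ℕ) (i j : Fin 3) : ℂ := (-1) ^ (p j * p i + p j + 1)

/-- The homomorphism `T_ij(w) ↦ s_ij T_{4-j,4-i}(w)` between the Yangians for two gradings, for
signs `s` that are compatible with the relations. -/
def transposeHom (p q : Fin 3 → ℕ) (s : Fin 3 → Fin 3 → ℂ) (c : ℂ) (D : Set ℂ)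
    (hcomm : ∀ i j k l : Fin 3, (-1 : ℂ) ^ ((p i + p j) * (p k + p l)) =
      (-1 : ℂ) ^ ((q j.rev + q i.rev) * (q l.rev + q k.rev)))
    (hexch : ∀ i j k l : Fin 3,
      s i j * s k l * -(-1 : ℂ) ^ ((q j.rev + q i.rev) * (q l.rev + q k.rev)
        + q l.rev * (q j.rev + q i.rev) + q j.rev * q i.rev) =
      (-1 : ℂ) ^ (p i * (p k + p l) + p k * p l) * (s k j * s i l)) :
    Yangian p c D →ₐ[ℂ] Yangian q c D :=
  RingQuot.liftAlgHom ℂ ⟨FreeAlgebra.lift ℂ fun x => s x.1 x.2.1 • T q c x.2.1.rev x.1.rev x.2.2, by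
    rintro _ _ ⟨i, j, k, l, u, v, huv⟩
    -- The column form is needed: transposition sends `T_kj T_il` to `T_{j.rev,k.rev}
    -- T_{l.rev,i.rev}`, which is this right-hand side in the correct order.
    have h := T_rtt_swap (p := q) (c := c) j.rev i.rev l.rev k.rev huv
    simp only [freeT, map_sub, map_mul, map_smul, FreeAlgebra.lift_ι_apply, smul_mul_smul_comm]
    rw [hcomm]
    calc _ = (s i j * s k l) • (T q c j.rev i.rev u * T q c l.rev k.rev v
          - (-1 : ℂ) ^ ((q j.rev + q i.rev) * (q l.rev + q k.rev)) •
            (T q c l.rev k.rev v * T q c j.rev i.rev u)) := by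
          rw [mul_comm (s k l)]; module
      _ = (s i j * s k l * -(-1 : ℂ) ^ ((q j.rev + q i.rev) * (q l.rev + q k.rev)
        + q l.rev * (q j.rev + q i.rev) + q j.rev * q i.rev) * gFun c u v) •
          (T q c j.rev k.rev v * T q c l.rev i.rev u
            - T q c j.rev k.rev u * T q c l.rev i.rev v) := by
          rw [h, smul_smul]; congr 1; ring
      _ = _ := by
          rw [hexch]; module⟩

@[simp]
theorem transposeHom_T {p q : Fin 3 → ℕ} {s : Fin 3 → Fin 3 → ℂ} {c : ℂ} {D : Set ℂ} (h₁ h₂)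
    (i j : Fin 3) (w : D) :
    transposeHom p q s c D h₁ h₂ (T p c i j w) = s i j • T q c j.rev i.rev w := by
  simp [transposeHom, T, freeT]

/-- Makes the transposition maps in the two directions mutually inverse; with complementary parities
the two exponents add up to an even number. -/
theorem transposeSign_mul_rev (i j : Fin 3) :
    transposeSign grading21 i j * transposeSign grading12 j.rev i.rev = 1 := by
  fin_cases i <;> fin_cases j <;> norm_num [grading21, grading12, Fin.rev, transposeSign]

theorem transposeSign_mul_rev' (i j : Fin 3) :
    transposeSign grading12 i j * transposeSign grading21 j.rev i.rev = 1 := by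
  fin_cases i <;> fin_cases j <;> norm_num [grading21, grading12, Fin.rev, transposeSign]

/-- The isomorphism `T_ij(w) ↦ (-1)^([j][i] + [j] + 1) T_{4-j,4-i}(w)` from `Y(gl(2|1))` to
`Y(gl(1|2))`. -/
def transposeEquiv (c : ℂ) (D : Set ℂ) : Yangian grading21 c D ≃ₐ[ℂ] Yangian grading12 c D :=
  AlgEquiv.ofAlgHom
    (transposeHom grading21 grading12 (transposeSign grading21) c D
      (by intro i j k l; fin_cases i <;> fin_cases j <;> fin_cases k <;> fin_cases l <;>
            norm_num [grading21, grading12, Fin.rev])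
      (by intro i j k l; fin_cases i <;> fin_cases j <;> fin_cases k <;> fin_cases l <;>
            norm_num [grading21, grading12, Fin.rev, transposeSign]))
    (transposeHom grading12 grading21 (transposeSign grading12) c D
      (by intro i j k l; fin_cases i <;> fin_cases j <;> fin_cases k <;> fin_cases l <;>
            norm_num [grading21, grading12, Fin.rev])
      (by intro i j k l; fin_cases i <;> fin_cases j <;> fin_cases k <;> fin_cases l <;>
            norm_num [grading21, grading12, Fin.rev, transposeSign]))
    (by
      apply algHom_ext
      intro i j w
      rw [AlgHom.comp_apply, transposeHom_T, map_smul, transposeHom_T, smul_smul, Fin.rev_rev,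
        Fin.rev_rev, AlgHom.id_apply, transposeSign_mul_rev', one_smul])
    (by
      apply algHom_ext
      intro i j w
      rw [AlgHom.comp_apply, transposeHom_T, map_smul, transposeHom_T, smul_smul, Fin.rev_rev,
        Fin.rev_rev, AlgHom.id_apply, transposeSign_mul_rev, one_smul])

theorem transposeSign_diag (i : Fin 3) : transposeSign grading21 i i = -1 := by
  fin_cases i <;> norm_num [grading21, transposeSign]

theorem transposeEquiv_T (c : ℂ) {D : Set ℂ} (i j : Fin 3) (w : D) :
    transposeEquiv c D (T grading21 c i j w) =
      transposeSign grading21 i j • T grading12 c j.rev i.rev w :=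
  transposeHom_T _ _ i j w

/-- The diagonal sign is always `-1`, exactly the discrepancy between the complementary parities of
`i` and `i.rev`. -/
theorem transposeEquiv_str (c : ℂ) {D : Set ℂ} (w : D) :
    transposeEquiv c D (str grading21 c w) = str grading12 c w := by
  simp only [str, map_add, map_smul, transposeEquiv_T, Fin.sum_univ_three]
  simp only [transposeSign_diag, show Fin.rev (0 : Fin 3) = 2 from rfl,
    show Fin.rev (1 : Fin 3) = 1 from rfl, show Fin.rev (2 : Fin 3) = 0 from rfl,
    show grading21 0 = 0 from rfl, show grading21 1 = 0 from rfl, show grading21 2 = 1 from rfl,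
    show grading12 0 = 0 from rfl, show grading12 1 = 1 from rfl, show grading12 2 = 1 from rfl,
    pow_zero, pow_one]
  module

/-- The order of factors is kept, so no reordering signs arise, only one `transposeSign` per factor.
-/
theorem transposeEquiv_prodT (c : ℂ) {D : Set ℂ} (i j : Fin 3) {n : ℕ} (x : Fin n → D)
    (S : Finset (Fin n)) :
    transposeEquiv c D (prodT grading21 c i j x S) =
      transposeSign grading21 i j ^ S.card • prodT grading12 c j.rev i.rev x S := by
  rw [prodT, prodT, ← Finset.length_sort (s := S) (· ≤ ·)]
  induction S.sort (· ≤ ·) with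
  | nil => simp
  | cons k L ih =>
    rw [List.map_cons, List.prod_cons, map_mul, ih, transposeEquiv_T, smul_mul_smul_comm,
      List.map_cons, List.prod_cons, List.length_cons, pow_succ']

theorem transposeEquiv_symRaise (c : ℂ) {D : Set ℂ} (i j : Fin 3) {n : ℕ} (x : Fin n → D)
    (S : Finset (Fin n)) :
    transposeEquiv c D (symRaise grading21 c i j x S) =
      transposeSign grading21 i j ^ S.card • symRaise grading12 c j.rev i.rev x S := by
  rw [symRaise, symRaise, map_smul, transposeEquiv_prodT, smul_comm]

theorem transposeEquiv_symLower (c : ℂ) {D : Set ℂ} (i j : Fin 3) {n : ℕ} (x : Fin n → D)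
    (S : Finset (Fin n)) :
    transposeEquiv c D (symLower grading21 c i j x S) =
      transposeSign grading21 i j ^ S.card • symLower grading12 c j.rev i.rev x S := by
  rw [symLower, symLower, map_smul, transposeEquiv_prodT, smul_comm]

end Transpose

/-! ### Words in the generators and functionals that vanish on them -/

section Words

variable (p : Fin 3 → ℕ) (c : ℂ) {D : Set ℂ}

/-- The product of a list of generators. -/
def word (L : List (Fin 3 × Fin 3 × D)) : Yangian p c D :=
  (L.map fun x => T p c x.1 x.2.1 x.2.2).prod

@[simp] theorem word_nil : word p c ([] : List (Fin 3 × Fin 3 × D)) = 1 := rfl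

@[simp] theorem word_cons (x : Fin 3 × Fin 3 × D) (L : List (Fin 3 × Fin 3 × D)) :
    word p c (x :: L) = T p c x.1 x.2.1 x.2.2 * word p c L := by
  simp [word]

@[simp] theorem word_append (L L' : List (Fin 3 × Fin 3 × D)) :
    word p c (L ++ L') = word p c L * word p c L' := by
  simp [word]

/-- The words in the generators span the Yangian. -/
theorem span_range_word : Submodule.span ℂ (Set.range (word p c (D := D))) = ⊤ := by
  rw [eq_top_iff]
  rintro y -
  obtain ⟨x, rfl⟩ := RingQuot.mkAlgHom_surjective ℂ (RTTRel p c D) y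
  have hx : x ∈ Submodule.span ℂ
      (Submonoid.closure (Set.range (FreeAlgebra.ι ℂ (X := Fin 3 × Fin 3 × D))) : Set _) := by
    rw [← Algebra.adjoin_eq_span, FreeAlgebra.adjoin_range_ι]
    exact Submodule.mem_top
  induction hx using Submodule.span_induction with
  | mem x hx =>
    apply Submodule.subset_span
    induction hx using Submonoid.closure_induction with
    | mem x hx =>
      obtain ⟨t, rfl⟩ := hx
      exact ⟨[t], by simp [T, freeT]⟩
    | one => exact ⟨[], by simp⟩
    | mul x y _ _ hx hy =>
      obtain ⟨L, hL⟩ := hx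
      obtain ⟨L', hL'⟩ := hy
      exact ⟨L ++ L', by rw [word_append, hL, hL', map_mul]⟩
  | zero => rw [map_zero]; exact Submodule.zero_mem _
  | add x y _ _ hx hy => rw [map_add]; exact Submodule.add_mem _ hx hy
  | smul a x _ hx => rw [map_smul]; exact Submodule.smul_mem _ a hx

variable {p c} (ℓ : Yangian p c D →ₗ[ℂ] ℂ)

/-- If the letters satisfying `Q` can be moved to the left through the other letters, then a
functional that vanishes on all words (with distinct spectral parameters) of a given length whose
first letter satisfies `Q` vanishes on all those that contain a letter satisfying `Q`. -/
theorem map_word_eq_zero_of_first (Q : Fin 3 × Fin 3 → Prop)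
    (hQ : ∀ x y : Fin 3 × Fin 3, Q x → ∃ x' y' : Fin 3 × Fin 3, Q x' ∧
      ∀ v w : D, v ≠ w → ∃ α β : ℂ, T p c y.1 y.2 v * T p c x.1 x.2 w
        = α • (T p c x.1 x.2 w * T p c y.1 y.2 v)
          + β • (T p c x'.1 x'.2 w * T p c y'.1 y'.2 v - T p c x'.1 x'.2 v * T p c y'.1 y'.2 w))
    {n : ℕ} (h : ∀ (x : Fin 3 × Fin 3) (w : D) (L : List (Fin 3 × Fin 3 × D)), Q x →
      L.length = n → (w :: L.map fun x => x.2.2).Nodup → ℓ (word p c ((x.1, x.2, w) :: L)) = 0)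
    (A B : List (Fin 3 × Fin 3 × D)) (x : Fin 3 × Fin 3) (w : D) (hx : Q x)
    (hlen : A.length + B.length = n)
    (hnd : ((A ++ (x.1, x.2, w) :: B).map fun x => x.2.2).Nodup) :
    ℓ (word p c (A ++ (x.1, x.2, w) :: B)) = 0 := by
  -- Induction on the prefix: exchanging with its last letter yields three words with a `Q`-letter
  -- one place further left, the same length and the same parameters up to order.
  induction A using List.reverseRecOn generalizing B x w with
  | nil => exact h x w B hx (by simpa using hlen) (by simpa using hnd)
  | append_singleton A y ih =>
    obtain ⟨k, l, v⟩ := y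
    rw [List.append_assoc, List.singleton_append] at hnd ⊢
    have hlen' : ∀ x : Fin 3 × Fin 3 × D, A.length + (x :: B).length = n := fun x => by
      rw [← hlen]; simp only [List.length_append, List.length_cons, List.length_nil]; omega
    have hnd' : ((A ++ (x.1, x.2, w) :: (k, l, v) :: B).map fun x => x.2.2).Nodup :=
      (((List.Perm.swap _ _ _).append_left A).map _).nodup_iff.mp hnd
    have hvw : v ≠ w := by
      rw [List.map_append, List.nodup_append] at hnd
      have := hnd.2.1
      simp only [List.map_cons, List.nodup_cons, List.mem_cons, not_or] at this
      exact this.1.1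
    obtain ⟨x', y', hx', hswap⟩ := hQ x (k, l) hx
    obtain ⟨α, β, hswap⟩ := hswap v w hvw
    have h₁ := ih ((k, l, v) :: B) x w hx (hlen' _) hnd'
    have h₂ := ih ((y'.1, y'.2, v) :: B) x' w hx' (hlen' _) (by simpa using hnd')
    have h₃ := ih ((y'.1, y'.2, w) :: B) x' v hx' (hlen' _) (by simpa using hnd)
    simp only [word_append, word_cons] at h₁ h₂ h₃ ⊢
    rw [← mul_assoc (T p c k l v), hswap]
    simp only [add_mul, mul_add, sub_mul, mul_sub, smul_mul_assoc, mul_smul_comm, map_add, map_sub,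
      map_smul, mul_assoc, h₁, h₂, h₃]
    simp

/-- A functional on the Yangian vanishes on all words with distinct spectral parameters if it
vanishes at `1`, on the left (right) ideal that the vacuum conditions provide, and on the words that
start or end with a diagonal letter as soon as it does so on all shorter ones. -/
theorem map_word_eq_zero_of_nodup (h_one : ℓ 1 = 0)
    (h_lower : ∀ (i j : Fin 3) (w : D) (A : Yangian p c D), j < i → ℓ (A * T p c i j w) = 0)
    (h_raise : ∀ (i j : Fin 3) (w : D) (A : Yangian p c D), i < j → ℓ (T p c i j w * A) = 0)
    (h_diag_right : ∀ (i : Fin 3) (w : D) (A : Yangian p c D), ℓ A = 0 → ℓ (A * T p c i i w) = 0)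
    (h_diag_left : ∀ (i : Fin 3) (w : D) (A : Yangian p c D), ℓ A = 0 → ℓ (T p c i i w * A) = 0)
    (L : List (Fin 3 × Fin 3 × D)) (hL : (L.map fun x => x.2.2).Nodup) :
    ℓ (word p c L) = 0 := by
  induction hn : L.length generalizing L with
  | zero => rw [List.length_eq_zero_iff.mp hn, word_nil, h_one]
  | succ n ih =>
    have hfirst : ∀ (i j : Fin 3) (w : D) (L : List (Fin 3 × Fin 3 × D)), i ≤ j →
        L.length = n → (w :: L.map fun x => x.2.2).Nodup → ℓ (word p c ((i, j, w) :: L)) = 0 := by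
      intro i j w L hij hL hnd
      rw [word_cons]
      obtain h | rfl := hij.lt_or_eq
      · exact h_raise _ _ _ _ h
      · exact h_diag_left _ _ _ (ih L (List.nodup_cons.mp hnd).2 hL)
    -- A letter in the first row is raising or diagonal, and row exchange always leaves a first-row
    -- letter on the left. The last column has the same property under column exchange.
    by_cases hrow : ∃ x ∈ L, x.1 = 0
    · obtain ⟨⟨i, j, w⟩, hx, hi⟩ := hrow
      obtain ⟨A, B, rfl⟩ := List.append_of_mem hx
      refine map_word_eq_zero_of_first ℓ (fun x => x.1 = 0) ?_ (n := n) ?_ A B (i, j) w hi ?_ hL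
      · rintro ⟨i, j⟩ ⟨k, l⟩ rfl
        exact ⟨(0, l), (k, j), rfl, fun v w hvw => ⟨_, _, T_mul_T_swap_rows k l 0 j hvw⟩⟩
      · rintro ⟨i, j⟩ w L rfl
        exact hfirst 0 j w L (Fin.zero_le j)
      · simpa [← add_assoc] using hn
    by_cases hcol : ∃ x ∈ L, x.2.1 = 2
    · obtain ⟨⟨i, j, w⟩, hx, hj⟩ := hcol
      obtain ⟨A, B, rfl⟩ := List.append_of_mem hx
      refine map_word_eq_zero_of_first ℓ (fun x => x.2 = 2) ?_ (n := n) ?_ A B (i, j) w hj ?_ hL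
      · rintro ⟨i, j⟩ ⟨k, l⟩ rfl
        exact ⟨(k, 2), (i, l), rfl, fun v w hvw => ⟨_, _, T_mul_T_swap_cols k l i 2 hvw⟩⟩
      · rintro ⟨i, j⟩ w L rfl
        exact hfirst i 2 w L (Fin.le_last i)
      · simpa [← add_assoc] using hn
    -- All remaining letters have row at least `1` and column at most `1`, so the last letter is
    -- lowering or diagonal and acts on the right without any exchange.
    push Not at hrow hcol
    obtain rfl | ⟨A, ⟨i, j, w⟩, rfl⟩ := List.eq_nil_or_concat' L
    · simp at hn
    rw [word_append, word_cons, word_nil, mul_one]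
    have hi := hrow (i, j, w) (by simp)
    have hj := hcol (i, j, w) (by simp)
    have hij : j ≤ i := by
      dsimp only at hi hj
      omega
    obtain h | rfl := hij.lt_or_eq
    · exact h_lower _ _ _ _ h
    · refine h_diag_right _ _ _ (ih A ?_ (by simpa using hn))
      rw [List.map_append] at hL
      exact hL.of_append_left

end Words

end Yangian

namespace Model

variable {c : ℂ} {D : Set ℂ}

/-! ### Vacuum expectation values are fixed by the eigenvalues -/

section Vev

variable {p : Fin 3 → ℕ} {H H' : Type*} [AddCommGroup H] [Module ℂ H] [AddCommGroup H']
  [Module ℂ H']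

/-- The vacuum expectation value `A ↦ Ω† A Ω`. -/
def vev (M : Model p c D H) : Yangian p c D →ₗ[ℂ] ℂ :=
  M.covac ∘ₗ LinearMap.applyₗ M.vac ∘ₗ M.rep.toLinearMap

theorem vev_apply (M : Model p c D H) (A : Yangian p c D) :
    M.vev A = M.covac (M.rep A M.vac) := rfl

theorem vev_one (M : Model p c D H) : M.vev 1 = 1 := by
  rw [vev_apply, map_one, Module.End.one_apply, M.covac_vac]

theorem vev_mul_lower (M : Model p c D H) (i j : Fin 3) (w : D) (A : Yangian p c D) (h : j < i) :
    M.vev (A * Yangian.T p c i j w) = 0 := by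
  rw [vev_apply, map_mul, Module.End.mul_apply, M.lower_vac i j w h, map_zero, map_zero]

theorem vev_raise_mul (M : Model p c D H) (i j : Fin 3) (w : D) (A : Yangian p c D) (h : i < j) :
    M.vev (Yangian.T p c i j w * A) = 0 := by
  rw [vev_apply, map_mul, Module.End.mul_apply, ← LinearMap.comp_apply, M.covac_raise i j w h,
    LinearMap.zero_apply]

theorem vev_mul_diag (M : Model p c D H) (i : Fin 3) (w : D) (A : Yangian p c D) :
    M.vev (A * Yangian.T p c i i w) = M.lam i w * M.vev A := by
  rw [vev_apply, map_mul, Module.End.mul_apply, M.diag_vac, map_smul, map_smul, smul_eq_mul,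
    vev_apply]

theorem vev_diag_mul (M : Model p c D H) (i : Fin 3) (w : D) (A : Yangian p c D) :
    M.vev (Yangian.T p c i i w * A) = M.lam i w * M.vev A := by
  rw [vev_apply, map_mul, Module.End.mul_apply, ← LinearMap.comp_apply, M.covac_diag,
    LinearMap.smul_apply, smul_eq_mul, vev_apply]

/-- The complement of a finite set is dense in an open set of spectral parameters. -/
theorem dense_compl_of_finite (hD : IsOpen D) (s : Set D) (hs : s.Finite) : Dense sᶜ := by
  intro x
  rw [Topology.IsInducing.subtypeVal.closure_eq_preimage_closure_image]
  have h : (D \ (Subtype.val '' s)) ⊆ Subtype.val '' sᶜ := by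
    rintro y ⟨hy, hys⟩
    exact ⟨⟨y, hy⟩, fun h => hys ⟨_, h, rfl⟩, rfl⟩
  refine closure_mono h ?_
  rw [Set.sdiff_eq]
  exact ((hs.image Subtype.val).countable.dense_compl ℂ).open_subset_closure_inter hD x.2

/-- The vacuum expectation values of a model are determined by its vacuum eigenvalues. -/
theorem vev_eq_of_lam_eq (hD : IsOpen D) (M : Model p c D H) (M' : Model p c D H')
    (h : M.lam = M'.lam) : M.vev = M'.vev := by
  rw [← sub_eq_zero]
  set ℓ := M.vev - M'.vev with hℓ
  -- Only the suffix `B` has distinct parameters. Letters of `A` join it one by one: off the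
  -- finitely many parameters of `B` the induction hypothesis applies, and continuity in the
  -- parameter of the joining letter fills in the rest.
  have key : ∀ A B : List (Fin 3 × Fin 3 × D), (B.map fun x => x.2.2).Nodup →
      ℓ (Yangian.word p c (A ++ B)) = 0 := by
    intro A
    induction A using List.reverseRecOn with
    | nil =>
      intro B hB
      refine Yangian.map_word_eq_zero_of_nodup ℓ ?_ ?_ ?_ ?_ ?_ B hB
      · rw [hℓ, LinearMap.sub_apply, vev_one, vev_one, sub_self]
      · intro i j w A hij
        rw [hℓ, LinearMap.sub_apply, vev_mul_lower _ _ _ _ _ hij, vev_mul_lower _ _ _ _ _ hij,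
          sub_self]
      · intro i j w A hij
        rw [hℓ, LinearMap.sub_apply, vev_raise_mul _ _ _ _ _ hij, vev_raise_mul _ _ _ _ _ hij,
          sub_self]
      · intro i w A hA
        rw [hℓ, LinearMap.sub_apply] at hA ⊢
        rw [vev_mul_diag, vev_mul_diag, h, ← mul_sub, hA, mul_zero]
      · intro i w A hA
        rw [hℓ, LinearMap.sub_apply] at hA ⊢
        rw [vev_diag_mul, vev_diag_mul, h, ← mul_sub, hA, mul_zero]
    | append_singleton A x ih =>
      intro B hB
      obtain ⟨i, j, w⟩ := x
      have hcont : Continuous fun w : D =>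
          ℓ (Yangian.word p c A * Yangian.T p c i j w * Yangian.word p c B) :=
        (M.regular _ _ i j).sub (M'.regular _ _ i j)
      have hdense := dense_compl_of_finite hD _ (B.map fun x => x.2.2).finite_toSet
      have hzero := hcont.ext_on hdense (continuous_const (y := (0 : ℂ))) (by
        intro w hw
        have := ih ((i, j, w) :: B) (by simpa using ⟨by simpa using hw, hB⟩)
        rwa [Yangian.word_append, Yangian.word_cons, ← mul_assoc] at this)
      have := congrFun hzero w
      simpa [mul_assoc] using this
  refine LinearMap.ext_on_range (Yangian.span_range_word p c) fun L => ?_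
  have := key L [] (by simp)
  rwa [List.append_nil] at this

end Vev

/-! ### Bethe vectors and form factors under transposition -/

section FormFactor

variable {H : Type*} [AddCommGroup H] [Module ℂ H]

/-- The form factors in terms of vacuum expectation values. -/
theorem formFactor21_eq_vev (M : Model grading21 c D H) (i j : Fin 3) (z : D) {a' a b' b : ℕ}
    (uC : Fin a' → D) (uB : Fin a → D) (vC : Fin b' → D) (vB : Fin b → D) :
    M.formFactor21 i j z uC uB vC vB =
      (-1 : ℂ) ^ (b' * (b' - 1) / 2) *
      ∑ P : Finset (Fin a') × Finset (Fin b') with P.1.card = P.2.card,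
        coeff21 c (M.lam 1) uC vC P.1 P.2 *
      ∑ Q : Finset (Fin a) × Finset (Fin b) with Q.1.card = Q.2.card,
        coeff21 c (M.lam 1) uB vB Q.1 Q.2 *
      M.vev (Yangian.symLower grading21 c 2 1 vC P.2ᶜ * Yangian.prodT grading21 c 1 0 uC P.1ᶜ
          * Yangian.symLower grading21 c 2 0 uC P.1 * (Yangian.T grading21 c i j z *
        (Yangian.symRaise grading21 c 0 2 uB Q.1 * Yangian.prodT grading21 c 0 1 uB Q.1ᶜ
        * Yangian.symRaise grading21 c 1 2 vB Q.2ᶜ))) := by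
  rw [formFactor21, dualBethe21, LinearMap.smul_apply, LinearMap.sum_apply, smul_eq_mul]
  simp only [bethe21, LinearMap.smul_apply, LinearMap.comp_apply, map_sum, map_smul, smul_eq_mul,
    vev_apply, map_mul, Module.End.mul_apply]
  refine congrArg _ (Finset.sum_congr rfl fun P _ => ?_)
  rw [Finset.mul_sum]
  exact Finset.sum_congr rfl fun Q _ => mul_left_comm _ _ _

theorem formFactor21_eq_of_lam_eq {H' : Type*} [AddCommGroup H'] [Module ℂ H'] (hD : IsOpen D)
    (M : Model grading21 c D H) (M' : Model grading21 c D H') (h : M.lam = M'.lam)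
    (i j : Fin 3) (z : D) {a' a b' b : ℕ}
    (uC : Fin a' → D) (uB : Fin a → D) (vC : Fin b' → D) (vB : Fin b → D) :
    M.formFactor21 i j z uC uB vC vB = M'.formFactor21 i j z uC uB vC vB := by
  rw [formFactor21_eq_vev, formFactor21_eq_vev, vev_eq_of_lam_eq hD M M' h, h]

/-- The `gl(2|1)` model obtained from a `gl(1|2)` model by pulling back along the isomorphism of the
Yangians. -/
def transpose (M : Model grading12 c D H) : Model grading21 c D H where
  rep := M.rep.comp (Yangian.transposeEquiv c D : _ →ₐ[ℂ] _)
  vac := M.vac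
  covac := M.covac
  lam k w := -M.lam k.rev w
  covac_vac := M.covac_vac
  lower_vac i j w hij := by
    simp [Yangian.transposeEquiv_T, M.lower_vac j.rev i.rev w (Fin.rev_lt_rev.mpr hij)]
  covac_raise i j w hij := by
    simp [Yangian.transposeEquiv_T, LinearMap.comp_smul,
      M.covac_raise j.rev i.rev w (Fin.rev_lt_rev.mpr hij)]
  diag_vac i w := by
    simp [Yangian.transposeEquiv_T, M.diag_vac, Yangian.transposeSign_diag]
  covac_diag i w := by
    simp [Yangian.transposeEquiv_T, M.covac_diag, Yangian.transposeSign_diag]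
  regular A B i j := by
    simpa [Yangian.transposeEquiv_T, mul_assoc, Function.comp_def] using
      (continuous_const_mul (Yangian.transposeSign grading21 i j)).comp
        (M.regular (Yangian.transposeEquiv c D A) (Yangian.transposeEquiv c D B) j.rev i.rev)

theorem transpose_rep_apply (M : Model grading12 c D H) (A : Yangian grading21 c D) :
    M.transpose.rep A = M.rep (Yangian.transposeEquiv c D A) := rfl

/-- The coefficients of the Bethe vectors for `gl(2|1)` and `gl(1|2)` agree up to a sign. -/
theorem coeff21_neg (lam2 : D → ℂ) {a b : ℕ} (u : Fin a → D) (v : Fin b → D)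
    (I : Finset (Fin a)) (J : Finset (Fin b)) :
    coeff21 c (fun w => -lam2 w) v u J I =
      (-1 : ℂ) ^ (b + Iᶜ.card) * coeff12 c lam2 u v I J := by
  have e : (-1 : ℂ) ^ (b + Iᶜ.card) * (-1 : ℂ) ^ (b + Iᶜ.card) = 1 := by
    rw [← mul_pow]; norm_num
  -- Only this sign is inverted explicitly, so no denominator has to be nonzero.
  have e' : ((-1 : ℂ) ^ (b + Iᶜ.card))⁻¹ = (-1 : ℂ) ^ (b + Iᶜ.card) := inv_eq_of_mul_eq_one_left e
  have hden : setProd (fFun c) u Finset.univ v Finset.univ * (∏ k, -lam2 (v k)) *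
      ∏ k ∈ Iᶜ, -lam2 (u k) = (-1 : ℂ) ^ (b + Iᶜ.card) * ((∏ k ∈ Iᶜ, lam2 (u k)) *
        (∏ k, lam2 (v k)) * setProd (fFun c) u Finset.univ v Finset.univ) := by
    rw [Finset.prod_neg, Finset.prod_neg, Finset.card_univ, Fintype.card_fin, pow_add]
    ring
  rw [coeff21, hden, coeff12, div_eq_mul_inv, mul_inv, e', div_eq_mul_inv]
  ring

theorem sum_card_eq_swap {a b : ℕ} {E : Type*} [AddCommMonoid E]
    (F : Finset (Fin b) × Finset (Fin a) → E) :
    ∑ P : Finset (Fin b) × Finset (Fin a) with P.1.card = P.2.card, F P =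
      ∑ P : Finset (Fin a) × Finset (Fin b) with P.1.card = P.2.card, F P.swap :=
  Finset.sum_equiv (Equiv.prodComm _ _) (by simp [eq_comm]) (by simp)

theorem bethe21_transpose (M : Model grading12 c D H) {a b : ℕ} (u : Fin a → D) (v : Fin b → D) :
    M.transpose.bethe21 v u = M.bethe12 u v := by
  rw [bethe21, bethe12, sum_card_eq_swap, Finset.smul_sum]
  refine Finset.sum_congr rfl ?_
  rintro ⟨I, J⟩ hIJ
  simp only [Finset.mem_filter, Finset.mem_univ, true_and] at hIJ
  have hI : I.card + Iᶜ.card = a := by simp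
  have hJ : J.card + Jᶜ.card = b := by simp
  rw [transpose_rep_apply]
  simp only [Prod.swap, map_mul, Yangian.transposeEquiv_symRaise, Yangian.transposeEquiv_prodT]
  -- The middle index is fixed by `Fin.rev`, so the pulled-back `λ₂` is just the negative of the
  -- original.
  change coeff21 c (fun w => -M.lam 1 w) v u J I • _ = _
  rw [coeff21_neg]
  have h02 : Yangian.transposeSign grading21 0 2 = 1 := by
    simp [Yangian.transposeSign, grading21]
  have h01 : Yangian.transposeSign grading21 0 1 = -1 := by
    norm_num [Yangian.transposeSign, grading21]
  have h12 : Yangian.transposeSign grading21 1 2 = 1 := by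
    simp [Yangian.transposeSign, grading21]
  -- Since `#I = #J`, `b + #Iᶜ = a + #Jᶜ`; this is the origin of the prefactor `(-1)^a` in the
  -- `gl(1|2)` Bethe vector.
  have hsign : (-1 : ℂ) ^ (b + Iᶜ.card) * (-1) ^ Jᶜ.card = (-1) ^ a := by
    rw [← pow_add, show b + Iᶜ.card + Jᶜ.card = a + 2 * Jᶜ.card by omega, pow_add, pow_mul]
    norm_num
  rw [h02, h01, h12, ← hsign]
  simp only [one_pow, one_smul, mul_smul_comm, smul_mul_assoc, map_smul, LinearMap.smul_apply,
    smul_smul]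
  congr 1
  ring

theorem dualBethe21_transpose (M : Model grading12 c D H) {a b : ℕ} (u : Fin a → D)
    (v : Fin b → D) : M.transpose.dualBethe21 v u = M.dualBethe12 u v := by
  rw [dualBethe21, dualBethe12, sum_card_eq_swap]
  congr 1
  refine Finset.sum_congr rfl ?_
  rintro ⟨I, J⟩ hIJ
  simp only [Finset.mem_filter, Finset.mem_univ, true_and] at hIJ
  have hI : I.card + Iᶜ.card = a := by simp
  have hJ : J.card + Jᶜ.card = b := by simp
  rw [transpose_rep_apply]
  simp only [Prod.swap, map_mul, Yangian.transposeEquiv_symLower, Yangian.transposeEquiv_prodT]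
  change coeff21 c (fun w => -M.lam 1 w) v u J I • _ = _
  rw [coeff21_neg]
  have h20 : Yangian.transposeSign grading21 2 0 = -1 := by
    norm_num [Yangian.transposeSign, grading21]
  have h10 : Yangian.transposeSign grading21 1 0 = -1 := by
    norm_num [Yangian.transposeSign, grading21]
  have h21 : Yangian.transposeSign grading21 2 1 = -1 := by
    norm_num [Yangian.transposeSign, grading21]
  -- All three lowering entries carry the sign `-1`, and `#J + #Jᶜ = b`, so the signs cancel without
  -- a prefactor.
  have hsign : (-1 : ℂ) ^ (b + Iᶜ.card) * ((-1) ^ Iᶜ.card * (-1) ^ Jᶜ.card * (-1) ^ J.card)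
      = 1 := by
    rw [← pow_add, ← pow_add, ← pow_add,
      show b + Iᶜ.card + (Iᶜ.card + Jᶜ.card + J.card) = 2 * (b + Iᶜ.card) by omega, pow_mul]
    norm_num
  rw [h20, h10, h21]
  simp only [mul_smul_comm, smul_mul_assoc, map_smul, LinearMap.comp_smul, smul_smul]
  congr 1
  linear_combination coeff12 c (M.lam 1) u v I J * hsign

theorem formFactor12_eq_transpose (M : Model grading12 c D H) (i j : Fin 3) (z : D)
    {a' a b' b : ℕ} (uC : Fin a' → D) (uB : Fin a → D) (vC : Fin b' → D) (vB : Fin b → D) :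
    M.formFactor12 i j z uC uB vC vB =
      (-1 : ℂ) ^ (grading12 j * grading12 i + grading12 j + 1) *
        M.transpose.formFactor21 j.rev i.rev z vC vB uC uB := by
  rw [formFactor12, formFactor21, bethe21_transpose, dualBethe21_transpose, transpose_rep_apply,
    Yangian.transposeEquiv_T, Fin.rev_rev, Fin.rev_rev, map_smul, LinearMap.smul_apply, map_smul,
    smul_eq_mul, ← mul_assoc]
  have h := Yangian.transposeSign_mul_rev' i j
  rw [Yangian.transposeSign] at h
  rw [h, one_mul]

end FormFactor

end Model

end

theorem mainTheorem5 (c : ℂ) (hc : c ≠ 0) (D : Set ℂ) (hD : IsOpen D) :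
    ∃ φ : Yangian grading21 c D ≃ₐ[ℂ] Yangian grading12 c D,
      (∀ (i j : Fin 3) (w : D), φ (Yangian.T grading21 c i j w) =
        (-1 : ℂ) ^ (grading21 j * grading21 i + grading21 j + 1) •
          Yangian.T grading12 c j.rev i.rev w) ∧
      (∀ w : D, φ (Yangian.str grading21 c w) = Yangian.str grading12 c w) ∧
      ∀ (Ht : Type*) [AddCommGroup Ht] [Module ℂ Ht] (Mt : Model grading12 c D Ht),
        (∃ M : Model grading21 c D Ht, M.rep = Mt.rep.comp (φ : _ →ₐ[ℂ] _) ∧ M.vac = Mt.vac ∧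
          M.covac = Mt.covac ∧ ∀ (k : Fin 3) (w : D), M.lam k w = -Mt.lam k.rev w) ∧
        ∀ (H : Type*) [AddCommGroup H] [Module ℂ H] (M : Model grading21 c D H),
          (∀ (k : Fin 3) (w : D), M.lam k w = -Mt.lam k.rev w) →
          ∀ (i j : Fin 3) (z : D) (a' a b' b : ℕ)
            (uC : Fin a' → D) (uB : Fin a → D) (vC : Fin b' → D) (vB : Fin b → D),
            Mt.formFactor12 i j z uC uB vC vB =
              (-1 : ℂ) ^ (grading12 j * grading12 i + grading12 j + 1) *
                M.formFactor21 j.rev i.rev z vC vB uC uB := by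
  refine ⟨Yangian.transposeEquiv c D, Yangian.transposeEquiv_T c, Yangian.transposeEquiv_str c,
    fun Ht _ _ Mt => ⟨⟨Mt.transpose, rfl, rfl, rfl, fun _ _ => rfl⟩, ?_⟩⟩
  intro H _ _ M hM i j z a' a b' b uC uB vC vB
  -- `M` need not be the pullback of `Mt`; equality of eigenvalues suffices to replace it by
  -- `Mt.transpose`.
  rw [Model.formFactor12_eq_transpose, Model.formFactor21_eq_of_lam_eq hD M Mt.transpose]
  funext k w
  exact hM k w
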